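/- Let $\mathbb{T}=\{z\in\mathbb{C}:|z|=1\}$ and let $n\ge 0$ be an integer. A one-variable trigonometric polynomial of degree at most $n$ is a function on $\mathbb{T}$ of the form $z\mapsto\sum_{k=-n}^{n}c_kz^k$ with $c_k\in\mathbb{C}$. Let $t_0,t_1$ be one-variable trigonometric polynomials of degree at most $n$, and suppose that the two-variable trigonometric polynomial $$t(z_1,z_2)=t_0(z_1)+z_2t_1(z_1)+\overline{z_2t_1(z_1)}$$ is real and non-negative, $t(z_1,z_2)\ge 0$, for all $(z_1,z_2)\in\mathbb{T}^2$. Then there exist polynomials $A_1,A_2\in\mathbb{C}[z_1,z_2]$, each of degree at most $n$ in $z_1$ and at most $1$ in $z_2$, such that $$t(z_1,z_2)=|A_1(z_1,z_2)|^2+|A_2(z_1,z_2)|^2\qquad\text{for all }(z_1,z_2)\in\mathbb{T}^2.$$ -/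

import Mathlib

open scoped ComplexOrder ComplexConjugate

/-- A function on the unit circle is a (complex) trigonometric polynomial of degree at most `n` if
it is of the form `z ↦ ∑_{k=-n}^{n} c_k z^k` with complex coefficients `c_k`. -/
def IsTrigPolynomial (n : ℕ) (f : Circle → ℂ) : Prop :=
  ∃ c : ℤ → ℂ, ∀ z : Circle, f z = ∑ k ∈ Finset.Icc (-(n : ℤ)) (n : ℤ), c k * (z : ℂ) ^ k

/-- A polynomial in `ℂ[z₁, z₂]` has degree at most `(n, m)` if its degree in `z₁` is at most `n`
and its degree in `z₂` is at most `m`. -/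
def HasBidegreeAtMost (n m : ℕ) (A : MvPolynomial (Fin 2) ℂ) : Prop :=
  A.degreeOf 0 ≤ n ∧ A.degreeOf 1 ≤ m

/-!
Write `t₀ + 2 Re (z₂ t₁) ≥ 0` for all `z₂` on the circle as `2|t₁| ≤ t₀`. This says that the matrix
trigonometric polynomial

  `M(z₁) = [[t₀ / 2, t₁], [conj t₁, t₀ / 2]]`

is positive semidefinite on the circle. If `M = Gᴴ G` with `G` a `2 × 2` matrix of polynomials of
degree at most `n`, then `A_i = G_{i0}(z₁) + z₂ G_{i1}(z₁)` satisfy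
`|A_1|² + |A_2|² = M₀₀ + M₁₁ + 2 Re (z₂ M₀₁) = t`. So the theorem follows from the matrix
Fejér–Riesz theorem, `exists_factor_of_posSemidef`, which is proved here for any matrix size.

For positive definite `M` (`exists_factor_of_posDef`) the factor comes from prediction theory. With
the continuous square root `C` of `M`, projecting in `L²` gives, for each `j`, an analytic vector
function `h_j` with constant term `e_j` such that `M h_j` is anti-analytic
(`exists_weighted_predictor`). Since `M` has degree `n`, the frequencies of `M h_j` lie in `[-n, 0]`,
so the matrix `P = M H` with these columns is a trigonometric polynomial and `H = M⁻¹ P` is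
continuous. The Hermitian matrix `Hᴴ M H = Hᴴ P` is anti-analytic, hence a constant `S`
(`conjTranspose_mul_const`), and `S` is positive definite. Therefore `M = P S⁻¹ Pᴴ`, and writing
`S⁻¹ = Rᴴ R` gives the factor `G = R Pᴴ`, a polynomial in `z` of degree at most `n`.

The semidefinite case is the limit of the factorizations of `M + ε` as `ε → 0`, since the
coefficients of the factors stay bounded.

Functions on the unit circle are treated as functions on `AddCircle T`, where `fourier k` plays the
role of `zᵏ`.
-/

open MeasureTheory AddCircle Matrix

/-! ### Fourier coefficients -/

section FourierCoeff

variable {T : ℝ} [hT : Fact (0 < T)]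

theorem fourierCoeff_fourier_mul (f : AddCircle T → ℂ) (p k : ℤ) :
    fourierCoeff (fun x => fourier p x * f x) k = fourierCoeff f (k - p) := by
  unfold fourierCoeff
  congr 1
  ext x
  rw [smul_eq_mul, smul_eq_mul, ← mul_assoc, ← fourier_add]
  congr 3
  ring

theorem fourierCoeff_conj (f : AddCircle T → ℂ) (k : ℤ) :
    fourierCoeff (fun x => conj (f x)) k = conj (fourierCoeff f (-k)) := by
  unfold fourierCoeff
  rw [← integral_conj]
  congr 1
  ext x
  rw [smul_eq_mul, smul_eq_mul, map_mul, ← fourier_neg, neg_neg]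

theorem fourierCoeff_fun_sum {κ : Type*} (s : Finset κ) (f : κ → AddCircle T → ℂ)
    (hf : ∀ i ∈ s, Integrable (f i) haarAddCircle) (k : ℤ) :
    fourierCoeff (fun x => ∑ i ∈ s, f i x) k = ∑ i ∈ s, fourierCoeff (f i) k := by
  have := congrFun (fourierCoeff.sum s f hf) k
  rw [Finset.sum_apply] at this
  rw [← this]
  congr 1
  ext x
  simp

theorem integrable_of_continuous {f : AddCircle T → ℂ} (hf : Continuous f) :
    Integrable f haarAddCircle :=
  hf.integrable_of_hasCompactSupport (HasCompactSupport.of_compactSpace f)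

theorem memLp_of_continuous {f : AddCircle T → ℂ} (hf : Continuous f) :
    MemLp f 2 haarAddCircle :=
  hf.memLp_of_hasCompactSupport (HasCompactSupport.of_compactSpace f)

theorem memLp_continuous_mul {a f : AddCircle T → ℂ} (ha : Continuous a)
    (hf : MemLp f 2 haarAddCircle) : MemLp (fun x => a x * f x) 2 haarAddCircle :=
  hf.mul (ha.memLp_of_hasCompactSupport (p := ⊤) (HasCompactSupport.of_compactSpace a))

theorem ae_eq_of_fourierCoeff_eq {f g : AddCircle T → ℂ} (hf : MemLp f 2 haarAddCircle)
    (hg : MemLp g 2 haarAddCircle) (h : ∀ k, fourierCoeff f k = fourierCoeff g k) :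
    f =ᵐ[haarAddCircle] g := by
  have key : hf.toLp f = hg.toLp g := by
    apply (fourierBasis (T := T)).repr.injective
    ext k
    rw [fourierBasis_repr, fourierBasis_repr, fourierCoeff_congr_ae hf.coeFn_toLp,
      fourierCoeff_congr_ae hg.coeFn_toLp, h]
  exact (MemLp.toLp_eq_toLp_iff hf hg).1 key

theorem fourierCoeff_sum_fourier (s : Finset ℤ) (c : ℤ → ℂ) (k : ℤ) :
    fourierCoeff (fun x : AddCircle T => ∑ p ∈ s, c p * fourier p x) k =
      if k ∈ s then c k else 0 := by
  rw [fourierCoeff_fun_sum s (fun p x => c p * fourier p x)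
    (fun p _ => integrable_of_continuous (continuous_const.mul (map_continuous (fourier p))))]
  simp_rw [fourierCoeff.const_mul, fourierCoeff_fourier, Pi.single_apply]
  simp

/-- A square-integrable function with finitely many nonzero Fourier coefficients is a
trigonometric polynomial. -/
theorem ae_eq_sum_fourier {f : AddCircle T → ℂ} (hf : MemLp f 2 haarAddCircle) (s : Finset ℤ)
    (h : ∀ k ∉ s, fourierCoeff f k = 0) :
    f =ᵐ[haarAddCircle] fun x => ∑ k ∈ s, fourierCoeff f k * fourier k x := by
  refine ae_eq_of_fourierCoeff_eq hf (memLp_of_continuous ?_) fun k => ?_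
  · exact continuous_finsetSum _ fun k _ => continuous_const.mul (map_continuous (fourier k))
  · rw [fourierCoeff_sum_fourier]
    split_ifs with hk
    · rfl
    · exact h k hk

theorem eq_of_ae_eq_haarAddCircle {f g : AddCircle T → ℂ} (hf : Continuous f) (hg : Continuous g)
    (h : f =ᵐ[haarAddCircle] g) : f = g :=
  (hf.ae_eq_iff_eq haarAddCircle hg).1 h

/-- A continuous function whose Fourier coefficients vanish away from `0` is constant. -/
theorem eq_fourierCoeff_zero {f : AddCircle T → ℂ} (hf : Continuous f)
    (h : ∀ k ≠ 0, fourierCoeff f k = 0) (x : AddCircle T) : f x = fourierCoeff f 0 := by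
  have := eq_of_ae_eq_haarAddCircle hf (by fun_prop)
    (ae_eq_sum_fourier (memLp_of_continuous hf) {0} fun k hk => h k (by simpa using hk))
  simpa using congrFun this x

end FourierCoeff

/-! ### Weighted prediction -/

section Prediction

variable {T : ℝ} [hT : Fact (0 < T)] {ι : Type*} [Fintype ι]

/-- The vector function `x ↦ zᵏ A(x)ᴴ e_l`, as an element of `L²`. Its inner product with `g` is the
`k`-th Fourier coefficient of the `l`-th component of `A g`, see `inner_coeffFunctional`. -/
noncomputable def coeffFunctional (A : C(AddCircle T, Matrix ι ι ℂ)) (l : ι) (k : ℤ) :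
    Lp (EuclideanSpace ℂ ι) 2 (haarAddCircle (T := T)) :=
  ContinuousMap.toLp 2 haarAddCircle ℂ
    ⟨fun x => WithLp.toLp 2 fun i => fourier k x * conj (A x l i), by
      refine (PiLp.continuous_toLp 2 _).comp (continuous_pi fun i => ?_)
      exact (map_continuous (fourier k)).mul
        (Complex.continuous_conj.comp (A.continuous.matrix_elem l i))⟩

theorem coeFn_coeffFunctional (A : C(AddCircle T, Matrix ι ι ℂ)) (l : ι) (k : ℤ) :
    coeffFunctional A l k =ᵐ[haarAddCircle]
      fun x => WithLp.toLp 2 fun i => fourier k x * conj (A x l i) :=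
  ContinuousMap.coeFn_toLp _ _

theorem inner_coeffFunctional (A : C(AddCircle T, Matrix ι ι ℂ)) (l : ι) (k : ℤ)
    (g : Lp (EuclideanSpace ℂ ι) 2 (haarAddCircle (T := T))) :
    inner ℂ (coeffFunctional A l k) g =
      fourierCoeff (fun x => (A x *ᵥ (g x).ofLp) l) k := by
  rw [L2.inner_def, fourierCoeff]
  apply integral_congr_ae
  filter_upwards [coeFn_coeffFunctional A l k] with x hx
  rw [hx, PiLp.inner_apply, smul_eq_mul, mulVec, dotProduct, Finset.mul_sum]
  refine Finset.sum_congr rfl fun i _ => ?_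
  simp only [RCLike.inner_apply, map_mul, Complex.conj_conj, fourier_neg]
  ring

/-- If `B` is the pointwise inverse of `Aᴴ`, the families attached to `A` and to `B` are
biorthogonal. -/
theorem inner_coeffFunctional_coeffFunctional [DecidableEq ι]
    (A B : C(AddCircle T, Matrix ι ι ℂ))
    (hBA : ∀ x, B x * (A x)ᴴ = 1) (l l' : ι) (k k' : ℤ) :
    inner ℂ (coeffFunctional B l k) (coeffFunctional A l' k') =
      if l = l' ∧ k = k' then 1 else 0 := by
  rw [inner_coeffFunctional]
  have : (fun x => (B x *ᵥ (coeffFunctional A l' k' x).ofLp) l) =ᵐ[haarAddCircle]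
      fun x => (1 : Matrix ι ι ℂ) l l' * fourier k' x := by
    filter_upwards [coeFn_coeffFunctional A l' k'] with x hx
    rw [hx, ← hBA x, mul_apply, mulVec, dotProduct, Finset.sum_mul]
    refine Finset.sum_congr rfl fun i _ => ?_
    simp only [conjTranspose_apply, RCLike.star_def]
    ring
  rw [fourierCoeff_congr_ae this, fourierCoeff.const_mul, fourierCoeff_fourier, one_apply,
    Pi.single_apply]
  by_cases h1 : l = l' <;> by_cases h2 : k = k' <;> simp [h1, h2]

theorem continuous_matrix_inv [DecidableEq ι] {X : Type*} [TopologicalSpace X]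
    {C : X → Matrix ι ι ℂ} (hC : Continuous C) (hdet : ∀ x, IsUnit (C x).det) :
    Continuous fun x => (C x)⁻¹ := by
  simp_rw [inv_def, Ring.inverse_eq_inv']
  exact (hC.matrix_det.inv₀ fun x => (hdet x).ne_zero).smul hC.matrix_adjugate

/-- **Weighted prediction.** Let `C` be a continuous invertible matrix weight. Projecting the `j`-th
column `C e_j` orthogonally to the closed span of all `zᵏ C e_l` with `k > 0` gives a
square-integrable `g` such that `C⁻¹ g` is analytic with constant term `e_j`, while
`Cᴴ g` is anti-analytic. -/
theorem exists_weighted_predictor [DecidableEq ι] (C : AddCircle T → Matrix ι ι ℂ)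
    (hC : Continuous C) (hdet : ∀ x, IsUnit (C x).det) (j : ι) :
    ∃ g : AddCircle T → ι → ℂ, (∀ l, MemLp (fun x => g x l) 2 haarAddCircle) ∧
      (∀ k > 0, ∀ l, fourierCoeff (fun x => ((C x)ᴴ *ᵥ g x) l) k = 0) ∧
      ∀ k ≤ 0, ∀ l, fourierCoeff (fun x => ((C x)⁻¹ *ᵥ g x) l) k =
        if l = j ∧ k = 0 then 1 else 0 := by
  have hinv := continuous_matrix_inv hC hdet
  -- The vectors attached to `A = Cᴴ` are the `zᵏ C e_l`; those attached to `B = C⁻¹` are dual to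
  -- them.
  let A : C(AddCircle T, Matrix ι ι ℂ) := ⟨fun x => (C x)ᴴ, hC.matrix_conjTranspose⟩
  let B : C(AddCircle T, Matrix ι ι ℂ) := ⟨fun x => (C x)⁻¹, hinv⟩
  have hBA : ∀ x, B x * (A x)ᴴ = 1 := fun x => by
    simp only [A, B, ContinuousMap.coe_mk, conjTranspose_conjTranspose]
    exact nonsing_inv_mul _ (hdet x)
  let V : Submodule ℂ (Lp (EuclideanSpace ℂ ι) 2 (haarAddCircle (T := T))) :=
    (Submodule.span ℂ {v | ∃ l, ∃ k > 0, v = coeffFunctional A l k}).topologicalClosure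
  have : CompleteSpace V := Submodule.isClosed_topologicalClosure _ |>.completeSpace_coe
  let g := coeffFunctional A j 0 - V.starProjection (coeffFunctional A j 0)
  refine ⟨fun x => (g x).ofLp, fun l => ?_, fun k hk l => ?_, fun k hk l => ?_⟩
  · exact (Lp.memLp g).eval_piLp l
  · have h1 : coeffFunctional A l k ∈ V :=
      Submodule.le_topologicalClosure _ (Submodule.subset_span ⟨l, k, hk, rfl⟩)
    have h2 : g ∈ Vᗮ := V.sub_starProjection_mem_orthogonal _
    rw [← Submodule.inner_right_of_mem_orthogonal h1 h2, inner_coeffFunctional]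
    rfl
  · have hV : V ≤ (ℂ ∙ coeffFunctional B l k)ᗮ := by
      refine Submodule.topologicalClosure_minimal _ (Submodule.span_le.2 ?_)
        (Submodule.isClosed_orthogonal _)
      rintro _ ⟨l', k', hk', rfl⟩
      rw [SetLike.mem_coe, Submodule.mem_orthogonal_singleton_iff_inner_right,
        inner_coeffFunctional_coeffFunctional A B hBA, if_neg]
      rintro ⟨-, rfl⟩
      exact absurd hk' (not_lt.2 hk)
    have h3 := (Submodule.mem_orthogonal_singleton_iff_inner_right).1
      (hV (V.starProjection_apply_mem (coeffFunctional A j 0)))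
    rw [← inner_coeffFunctional_coeffFunctional A B hBA, ← sub_zero (inner ℂ _ _), ← h3,
      ← inner_sub_right, inner_coeffFunctional]
    rfl

end Prediction

/-! ### Positive definite matrix weights -/

section PosDef

variable {T : ℝ} [hT : Fact (0 < T)] {ι : Type*} [Fintype ι] [DecidableEq ι]

open scoped Matrix.Norms.L2Operator MatrixOrder in
theorem exists_continuous_sqrt {X : Type*} [TopologicalSpace X] {M : X → Matrix ι ι ℂ}
    (hM : Continuous M) (hpos : ∀ x, (M x).PosSemidef) :
    ∃ C : X → Matrix ι ι ℂ, Continuous C ∧ (∀ x, (C x)ᴴ = C x) ∧ ∀ x, C x * C x = M x := by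
  refine ⟨fun x => CFC.sqrt (M x), ?_, fun x => ?_, fun x => ?_⟩
  · exact CFC.continuousOn_sqrt.comp_continuous hM fun x => (hpos x).nonneg
  · exact (CFC.sqrt_nonneg (M x)).posSemidef.isHermitian
  · exact CFC.sqrt_mul_sqrt_self (M x) (hpos x).nonneg

omit [DecidableEq ι] in
/-- Multiplication by a trigonometric polynomial with frequencies in `[-n, n]` moves the Fourier
coefficients of an analytic function by at most `n`. -/
theorem fourierCoeff_trig_mulVec_eq_zero {n : ℕ} {M : AddCircle T → Matrix ι ι ℂ}
    (c : ℤ → Matrix ι ι ℂ)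
    (hM : ∀ x, M x = ∑ p ∈ Finset.Icc (-(n : ℤ)) n, (fourier p x : ℂ) • c p)
    {h : AddCircle T → ι → ℂ} (hh : ∀ l, MemLp (fun x => h x l) 2 haarAddCircle)
    (h0 : ∀ k < 0, ∀ l, fourierCoeff (fun x => h x l) k = 0) {k : ℤ} (hk : k < -n) (l : ι) :
    fourierCoeff (fun x => (M x *ᵥ h x) l) k = 0 := by
  have h1 : (fun x => (M x *ᵥ h x) l) = fun x => ∑ m : ι, ∑ p ∈ Finset.Icc (-(n : ℤ)) n,
      c p l m * (fourier p x * h x m) := by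
    ext x
    simp only [mulVec, dotProduct, hM, Matrix.sum_apply, Finset.sum_mul, Matrix.smul_apply,
      smul_eq_mul]
    exact Finset.sum_congr rfl fun m _ => Finset.sum_congr rfl fun p _ => by ring
  have hint : ∀ m p, Integrable (fun x => c p l m * (fourier p x * h x m)) haarAddCircle :=
    fun m p => ((memLp_continuous_mul (map_continuous (fourier p)) (hh m)).integrable
      (by norm_num)).const_mul _
  rw [h1, fourierCoeff_fun_sum _ (fun m x => ∑ p ∈ Finset.Icc (-(n : ℤ)) n,
      c p l m * (fourier p x * h x m)) fun m _ => integrable_finsetSum _ fun p _ => hint m p]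
  refine Finset.sum_eq_zero fun m _ => ?_
  rw [fourierCoeff_fun_sum _ (fun p x => c p l m * (fourier p x * h x m)) fun p _ => hint m p]
  refine Finset.sum_eq_zero fun p hp => ?_
  rw [fourierCoeff.const_mul, fourierCoeff_fourier_mul, h0, mul_zero]
  have := (Finset.mem_Icc.1 hp).1
  omega

omit [DecidableEq ι] in
/-- Here analytic means that the Fourier coefficients of negative index vanish, and anti-analytic
that those of positive index vanish. If `H` is continuous and analytic and `P` is an anti-analytic
trigonometric polynomial, then `Hᴴ P` is anti-analytic; if it is moreover Hermitian, it is
constant. -/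
theorem conjTranspose_mul_const {H P : AddCircle T → Matrix ι ι ℂ} (hH : Continuous H)
    (s : Finset ℤ) (hs : ∀ p ∈ s, p ≤ 0) (c : ℤ → Matrix ι ι ℂ)
    (hP : ∀ x, P x = ∑ p ∈ s, (fourier p x : ℂ) • c p)
    (hH0 : ∀ k < 0, ∀ l j, fourierCoeff (fun x => H x l j) k = 0)
    (hherm : ∀ x, ((H x)ᴴ * P x).IsHermitian) :
    ∃ S : Matrix ι ι ℂ, ∀ x, (H x)ᴴ * P x = S := by
  have hcont : ∀ i j, Continuous fun x => ((H x)ᴴ * P x) i j := fun i j => by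
    have : Continuous P := by
      rw [funext hP]
      exact continuous_finsetSum _ fun p _ => (map_continuous (fourier p)).smul continuous_const
    exact (hH.matrix_conjTranspose.matrix_mul this).matrix_elem i j
  have hpos : ∀ k > 0, ∀ i j, fourierCoeff (fun x => ((H x)ᴴ * P x) i j) k = 0 := by
    intro k hk i j
    have h1 : (fun x => ((H x)ᴴ * P x) i j) = fun x => ∑ l : ι, ∑ p ∈ s,
        c p l j * (fourier p x * conj (H x l i)) := by
      ext x
      simp only [mul_apply, hP, Matrix.sum_apply, Finset.mul_sum, Matrix.smul_apply,
        smul_eq_mul, conjTranspose_apply, RCLike.star_def]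
      exact Finset.sum_congr rfl fun m _ => Finset.sum_congr rfl fun p _ => by ring
    have hint : ∀ l p, Integrable (fun x => c p l j * (fourier p x * conj (H x l i)))
        haarAddCircle := fun l p => integrable_of_continuous (continuous_const.mul
      ((map_continuous (fourier p)).mul (Complex.continuous_conj.comp (hH.matrix_elem l i))))
    rw [h1, fourierCoeff_fun_sum _ (fun l x => ∑ p ∈ s,
        c p l j * (fourier p x * conj (H x l i)))
        fun l _ => integrable_finsetSum _ fun p _ => hint l p]
    refine Finset.sum_eq_zero fun l _ => ?_
    rw [fourierCoeff_fun_sum _ (fun p x => c p l j * (fourier p x * conj (H x l i)))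
      fun p _ => hint l p]
    refine Finset.sum_eq_zero fun p hp => ?_
    rw [fourierCoeff.const_mul, fourierCoeff_fourier_mul, fourierCoeff_conj, hH0, map_zero,
      mul_zero]
    have := hs p hp
    omega
  refine ⟨Matrix.of fun i j => fourierCoeff (fun x => ((H x)ᴴ * P x) i j) 0, fun x => ?_⟩
  ext i j
  rw [of_apply]
  refine eq_fourierCoeff_zero (hcont i j) (fun k hk => ?_) x
  rcases hk.lt_or_gt with hk | hk
  · have h2 : (fun x => ((H x)ᴴ * P x) i j) = fun x => conj (((H x)ᴴ * P x) j i) := by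
      ext x
      exact ((hherm x).apply i j).symm
    rw [h2, fourierCoeff_conj, hpos _ (by omega), map_zero]
  · exact hpos k hk i j

/-- **Matrix Fejér–Riesz theorem**, positive definite case. The predictors for the weight `√M` form
the columns of an analytic `H` with mean value `1` such that `P = M H` is an anti-analytic
polynomial of degree at most `n`. Then `S = Hᴴ M H` is constant, and eliminating `H` gives
`M = P S⁻¹ Pᴴ`. -/
theorem exists_factor_of_posDef {n : ℕ} {M : AddCircle T → Matrix ι ι ℂ}
    (c : ℤ → Matrix ι ι ℂ)
    (hM : ∀ x, M x = ∑ p ∈ Finset.Icc (-(n : ℤ)) n, (fourier p x : ℂ) • c p)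
    (hpos : ∀ x, (M x).PosDef) :
    ∃ a : Fin (n + 1) → Matrix ι ι ℂ, ∀ x,
      M x = (∑ k : Fin (n + 1), (fourier ((k : ℕ) : ℤ) x : ℂ) • a k)ᴴ *
        ∑ k : Fin (n + 1), (fourier ((k : ℕ) : ℤ) x : ℂ) • a k := by
  have hMc : Continuous M := by
    rw [funext hM]
    exact continuous_finsetSum _ fun p _ => (map_continuous (fourier p)).smul continuous_const
  have hMdet : ∀ x, IsUnit (M x).det := fun x => (hpos x).det_pos.ne'.isUnit
  obtain ⟨C, hCc, hCh, hCC⟩ := exists_continuous_sqrt hMc fun x => (hpos x).posSemidef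
  have hCdet : ∀ x, IsUnit (C x).det := fun x => by
    have := hMdet x
    rw [← hCC, det_mul] at this
    exact isUnit_of_mul_isUnit_left this
  choose g hgL hgneg hgpos using fun j => exists_weighted_predictor C hCc hCdet j
  simp_rw [hCh] at hgneg
  have hmemLp : ∀ {A : AddCircle T → Matrix ι ι ℂ}, Continuous A → ∀ j l,
      MemLp (fun x => (A x *ᵥ g j x) l) 2 haarAddCircle := fun {A} hA j l => by
    simp only [mulVec, dotProduct]
    exact memLp_finsetSum _ fun i _ => memLp_continuous_mul (hA.matrix_elem l i) (hgL j i)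
  have hMg : ∀ j x, M x *ᵥ ((C x)⁻¹ *ᵥ g j x) = C x *ᵥ g j x := fun j x => by
    rw [mulVec_mulVec, ← hCC, mul_nonsing_inv_cancel_right _ _ (hCdet x)]
  -- The anti-analytic functions `C g_j = M C⁻¹ g_j` only have frequencies in `[-n, 0]`.
  have hK : ∀ j l, (fun x => (C x *ᵥ g j x) l) =ᵐ[haarAddCircle] fun x =>
      ∑ k ∈ Finset.Icc (-(n : ℤ)) 0,
        fourierCoeff (fun x => (C x *ᵥ g j x) l) k * fourier k x := fun j l => by
    refine ae_eq_sum_fourier (hmemLp hCc j l) _ fun k hk => ?_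
    rcases lt_or_ge 0 k with h | h
    · exact hgneg j k h l
    · simp_rw [← hMg]
      refine fourierCoeff_trig_mulVec_eq_zero c hM
        (hmemLp (continuous_matrix_inv hCc hCdet) j) (fun k hk l => ?_) ?_ l
      · rw [hgpos j k hk.le, if_neg fun h => hk.ne h.2]
      · simp only [Finset.mem_Icc, not_and, not_le] at hk
        by_contra! h'
        exact absurd (hk h') (not_lt.2 h)
  -- Hence `P`, the polynomial with columns `C g_j`, and `H = M⁻¹ P` are continuous representatives
  -- of the square-integrable functions `C g_j` and `C⁻¹ g_j`.
  let κ : ℤ → Matrix ι ι ℂ := fun k =>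
    Matrix.of fun l j => fourierCoeff (fun x => (C x *ᵥ g j x) l) k
  let P : AddCircle T → Matrix ι ι ℂ := fun x =>
    ∑ k ∈ Finset.Icc (-(n : ℤ)) 0, (fourier k x : ℂ) • κ k
  have hPc : Continuous P :=
    continuous_finsetSum _ fun p _ => (map_continuous (fourier p)).smul continuous_const
  let H : AddCircle T → Matrix ι ι ℂ := fun x => (M x)⁻¹ * P x
  have hHc : Continuous H := (continuous_matrix_inv hMc hMdet).matrix_mul hPc
  have hMH : ∀ x, M x * H x = P x := fun x => mul_nonsing_inv_cancel_left _ _ (hMdet x)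
  have hHg : ∀ l j, (fun x => ((C x)⁻¹ *ᵥ g j x) l) =ᵐ[haarAddCircle] fun x => H x l j := by
    intro l j
    filter_upwards [Filter.eventually_all.2 fun l => hK j l] with x hx
    have h1 : C x *ᵥ g j x = (P x).col j := by
      ext i
      rw [hx i]
      simp [P, κ, Matrix.sum_apply, mul_comm]
    have h2 : (C x)⁻¹ *ᵥ g j x = (M x)⁻¹ *ᵥ (C x *ᵥ g j x) := by
      rw [← hMg, mulVec_mulVec _ (M x)⁻¹, nonsing_inv_mul _ (hMdet x), one_mulVec]
    rw [h2, h1]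
    rfl
  have hHcoeff : ∀ k ≤ 0, ∀ l j, fourierCoeff (fun x => H x l j) k =
      if l = j ∧ k = 0 then 1 else 0 := fun k hk l j => by
    rw [← fourierCoeff_congr_ae (hHg l j), hgpos j k hk]
  have hHPH : ∀ x, (H x)ᴴ * P x = (H x)ᴴ * M x * H x := fun x => by
    rw [Matrix.mul_assoc, hMH]
  obtain ⟨S, hS⟩ := conjTranspose_mul_const (P := P) hHc (Finset.Icc (-(n : ℤ)) 0)
    (fun p hp => (Finset.mem_Icc.1 hp).2) κ (fun x => rfl)
    (fun k hk l j => by rw [hHcoeff k hk.le, if_neg fun h => hk.ne h.2])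
    (fun x => by
      rw [hHPH]
      exact isHermitian_conjTranspose_mul_mul _ (hpos x).isHermitian)
  simp_rw [hHPH] at hS
  -- A null vector `v` of `S` satisfies `H v = 0` everywhere, so taking mean values gives `v = 0`.
  have hSpos : S.PosDef := by
    refine PosDef.of_dotProduct_mulVec_pos ?_ fun v hv => ?_
    · rw [← hS 0]
      exact isHermitian_conjTranspose_mul_mul _ (hpos 0).isHermitian
    · have hq : ∀ x, star v ⬝ᵥ S *ᵥ v = star (H x *ᵥ v) ⬝ᵥ M x *ᵥ (H x *ᵥ v) := fun x => by
        rw [← hS x, star_mulVec, dotProduct_mulVec, dotProduct_mulVec, vecMul_vecMul,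
          dotProduct_mulVec, vecMul_vecMul, Matrix.mul_assoc]
      by_contra hneg
      have hHv : ∀ x, H x *ᵥ v = 0 := fun x => by
        by_contra hne
        exact hneg (hq x ▸ (hpos x).dotProduct_mulVec_pos hne)
      apply hv
      ext l
      have h1 : fourierCoeff (fun x => ∑ j, v j * H x l j) 0 = v l := by
        rw [fourierCoeff_fun_sum _ (fun j x => v j * H x l j) fun j _ =>
          integrable_of_continuous (continuous_const.mul (hHc.matrix_elem l j))]
        simp [fourierCoeff.const_mul, hHcoeff]
      have h2 : (fun x => ∑ j, v j * H x l j) = fun _ => 0 := by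
        ext x
        have := congrFun (hHv x) l
        simpa [mulVec, dotProduct, mul_comm] using this
      rw [← h1, h2]
      simp [fourierCoeff]
  obtain ⟨R, hR⟩ : ∃ R : Matrix ι ι ℂ, S⁻¹ = Rᴴ * R := by
    obtain ⟨C, -, h1, h2⟩ := exists_continuous_sqrt (X := Unit) (M := fun _ => S⁻¹)
      continuous_const fun _ => hSpos.inv.posSemidef
    exact ⟨C (), by rw [h1, h2]⟩
  have hSdet : IsUnit S.det := hSpos.det_pos.ne'.isUnit
  have hMP : ∀ x, M x = P x * S⁻¹ * (P x)ᴴ := fun x => by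
    have hHdet : IsUnit (H x).det := by
      have := hSdet
      rw [← hS x, det_mul] at this
      exact isUnit_of_mul_isUnit_right this
    have h1 : S⁻¹ * ((H x)ᴴ * M x) = (H x)⁻¹ := by
      refine (inv_eq_left_inv ?_).symm
      rw [Matrix.mul_assoc, hS, nonsing_inv_mul _ hSdet]
    have h2 : (P x)ᴴ = (H x)ᴴ * M x := by
      rw [← hMH, conjTranspose_mul, (hpos x).isHermitian.eq]
    rw [h2, Matrix.mul_assoc, h1, ← hMH, mul_nonsing_inv_cancel_right _ _ hHdet]
  refine ⟨fun k => R * (κ (-((k : ℕ) : ℤ)))ᴴ, fun x => ?_⟩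
  have hG : ∑ k : Fin (n + 1), (fourier ((k : ℕ) : ℤ) x : ℂ) • (R * (κ (-((k : ℕ) : ℤ)))ᴴ) =
      R * (P x)ᴴ := by
    simp only [P, conjTranspose_sum, Finset.mul_sum, conjTranspose_smul]
    refine Finset.sum_bij (fun k _ => -((k : ℕ) : ℤ)) ?_ ?_ ?_ ?_
    · intro k _
      simp only [Finset.mem_Icc]
      omega
    · intro a _ b _ h
      ext
      simpa using h
    · intro b hb
      rw [Finset.mem_Icc] at hb
      exact ⟨⟨b.natAbs, by omega⟩, Finset.mem_univ _, by simp only; omega⟩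
    · intro k _
      rw [RCLike.star_def, ← fourier_neg, neg_neg, Matrix.mul_smul]
  rw [hG, conjTranspose_mul, conjTranspose_conjTranspose, hMP, hR]
  simp only [Matrix.mul_assoc]

end PosDef

/-! ### Positive semidefinite matrix weights -/

section PosSemidef

variable {T : ℝ} [hT : Fact (0 < T)] {ι : Type*} [Fintype ι] [DecidableEq ι]

omit [DecidableEq ι] in
theorem norm_sq_le_conjTranspose_mul_self_apply (G : Matrix ι ι ℂ) (i j : ι) :
    ‖G i j‖ ^ 2 ≤ ((Gᴴ * G) j j).re := by
  have : (Gᴴ * G) j j = ((∑ l, ‖G l j‖ ^ 2 : ℝ) : ℂ) := by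
    simp [mul_apply, Complex.conj_mul']
  rw [this, Complex.ofReal_re]
  exact Finset.single_le_sum (f := fun l => ‖G l j‖ ^ 2) (fun _ _ => by positivity)
    (Finset.mem_univ i)

omit [Fintype ι] [DecidableEq ι] in
/-- The entries of the coefficients of a matrix polynomial are Fourier coefficients of its entries,
so a uniform bound on the circle bounds them. -/
theorem norm_coeff_le (n : ℕ) (a : Fin (n + 1) → Matrix ι ι ℂ) {B : ℝ} (i j : ι)
    (hB : ∀ x : AddCircle T,
      ‖(∑ k : Fin (n + 1), (fourier ((k : ℕ) : ℤ) x : ℂ) • a k) i j‖ ≤ B) (k : Fin (n + 1)) :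
    ‖a k i j‖ ≤ B := by
  have h1 : fourierCoeff (fun x : AddCircle T => (∑ k : Fin (n + 1),
      (fourier ((k : ℕ) : ℤ) x : ℂ) • a k) i j) k = a k i j := by
    have : (fun x : AddCircle T => (∑ k : Fin (n + 1),
        (fourier ((k : ℕ) : ℤ) x : ℂ) • a k) i j) =
        fun x => ∑ k : Fin (n + 1), a k i j * fourier ((k : ℕ) : ℤ) x := by
      ext x
      simp [Matrix.sum_apply, mul_comm]
    rw [this, fourierCoeff_fun_sum _ (fun (k : Fin (n + 1)) x => a k i j * fourier ((k : ℕ) : ℤ) x)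
      fun k _ => integrable_of_continuous (continuous_const.mul (map_continuous (fourier _)))]
    simp_rw [fourierCoeff.const_mul, fourierCoeff_fourier, Pi.single_apply]
    simp [Fin.val_inj]
  rw [← h1, fourierCoeff]
  refine (norm_integral_le_of_norm_le_const (C := B)
    (Filter.Eventually.of_forall fun x => ?_)).trans (by simp)
  rw [norm_smul, fourier_apply, Circle.norm_coe, one_mul]
  exact hB x

/-- **Matrix Fejér–Riesz theorem**: a positive semidefinite matrix-valued trigonometric polynomial
of degree at most `n` is `Gᴴ G` for an analytic matrix polynomial `G` of degree at most `n`. It is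
the limit of the positive definite case, applied to `M + ε`. -/
theorem exists_factor_of_posSemidef {n : ℕ} {M : AddCircle T → Matrix ι ι ℂ}
    (c : ℤ → Matrix ι ι ℂ)
    (hM : ∀ x, M x = ∑ p ∈ Finset.Icc (-(n : ℤ)) n, (fourier p x : ℂ) • c p)
    (hpos : ∀ x, (M x).PosSemidef) :
    ∃ a : Fin (n + 1) → Matrix ι ι ℂ, ∀ x,
      M x = (∑ k : Fin (n + 1), (fourier ((k : ℕ) : ℤ) x : ℂ) • a k)ᴴ *
        ∑ k : Fin (n + 1), (fourier ((k : ℕ) : ℤ) x : ℂ) • a k := by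
  have hMc : Continuous M := by
    rw [funext hM]
    exact continuous_finsetSum _ fun p _ => (map_continuous (fourier p)).smul continuous_const
  have hfac : ∀ m : ℕ, ∃ a : Fin (n + 1) → Matrix ι ι ℂ, ∀ x,
      M x + ((1 / ((m : ℝ) + 1) : ℝ) : ℂ) • (1 : Matrix ι ι ℂ) =
        (∑ k : Fin (n + 1), (fourier ((k : ℕ) : ℤ) x : ℂ) • a k)ᴴ *
        ∑ k : Fin (n + 1), (fourier ((k : ℕ) : ℤ) x : ℂ) • a k := fun m => by
    refine exists_factor_of_posDef
      (fun p => c p + if p = 0 then ((1 / ((m : ℝ) + 1) : ℝ) : ℂ) • (1 : Matrix ι ι ℂ) else 0)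
      (fun x => ?_) (fun x => ?_)
    · have h0 : (0 : ℤ) ∈ Finset.Icc (-(n : ℤ)) n := by simp
      simp only [smul_add, smul_ite, smul_zero, Finset.sum_add_distrib, Finset.sum_ite_eq', h0,
        if_true, fourier_zero, one_smul, hM]
    · refine PosDef.posSemidef_add (hpos x) (PosDef.one.smul ?_)
      rw [Complex.zero_lt_real]
      positivity
  choose a ha using hfac
  -- The diagonal of `M` dominates the entries of all factors, hence their coefficients.
  obtain ⟨B, hB⟩ : ∃ B : ℝ, ∀ x j, ((M x) j j).re ≤ B := by
    have h1 : ∀ j, ∃ B, ∀ x, ((M x) j j).re ≤ B := fun j => by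
      obtain ⟨B, hB⟩ := isCompact_univ.bddAbove_image
        (Complex.continuous_re.comp (hMc.matrix_elem j j)).continuousOn
      exact ⟨B, fun x => hB ⟨x, trivial, rfl⟩⟩
    choose B hB using h1
    exact ⟨∑ j, |B j|, fun x j => (hB j x).trans ((le_abs_self _).trans
      (Finset.single_le_sum (f := fun j => |B j|) (fun _ _ => abs_nonneg _) (Finset.mem_univ j)))⟩
  have hbound : ∀ m k i j, ‖a m k i j‖ ≤ √(B + 1) := fun m k i j => by
    refine norm_coeff_le (T := T) n (a m) i j (fun x => ?_) k
    refine Real.le_sqrt_of_sq_le ((norm_sq_le_conjTranspose_mul_self_apply _ i j).trans ?_)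
    rw [← ha m x, Matrix.add_apply, Matrix.smul_apply, one_apply_eq, smul_eq_mul, mul_one,
      Complex.add_re, Complex.ofReal_re]
    refine add_le_add (hB x j) ?_
    rw [div_le_one (by positivity)]
    linarith [(Nat.cast_nonneg m : (0 : ℝ) ≤ m)]
  let b : ℕ → Fin (n + 1) → ι → ι → ℂ := fun m k i j => a m k i j
  obtain ⟨L, -, φ, hφ, hL⟩ := tendsto_subseq_of_bounded (x := b)
    (Metric.isBounded_closedBall (x := 0) (r := √(B + 1))) fun m => by
      rw [mem_closedBall_zero_iff]
      simp only [pi_norm_le_iff_of_nonneg (Real.sqrt_nonneg _)]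
      exact hbound m
  refine ⟨fun k => Matrix.of (L k), fun x => ?_⟩
  let Φ : (Fin (n + 1) → ι → ι → ℂ) → Matrix ι ι ℂ := fun d =>
    (∑ k : Fin (n + 1), (fourier ((k : ℕ) : ℤ) x : ℂ) • Matrix.of (d k))ᴴ *
        ∑ k : Fin (n + 1), (fourier ((k : ℕ) : ℤ) x : ℂ) • Matrix.of (d k)
  have hΦ : Continuous Φ := by
    have h1 : Continuous fun d : Fin (n + 1) → ι → ι → ℂ =>
        ∑ k : Fin (n + 1), (fourier ((k : ℕ) : ℤ) x : ℂ) • Matrix.of (d k) := by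
      refine continuous_matrix fun i j => ?_
      simp only [Matrix.sum_apply, Matrix.smul_apply, of_apply]
      fun_prop
    exact h1.matrix_conjTranspose.matrix_mul h1
  refine tendsto_nhds_unique (f := fun m => Φ (b (φ m))) (l := Filter.atTop) ?_
    ((hΦ.tendsto L).comp hL)
  have h2 : (fun m => Φ (b (φ m))) = fun m =>
      M x + ((1 / ((φ m : ℝ) + 1) : ℝ) : ℂ) • (1 : Matrix ι ι ℂ) :=
    funext fun m => (ha (φ m) x).symm
  have h3 : Filter.Tendsto (fun m => ((1 / ((φ m : ℝ) + 1) : ℝ) : ℂ)) Filter.atTop (nhds 0) := by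
    rw [← Complex.ofReal_zero]
    exact (Complex.continuous_ofReal.tendsto 0).comp
      (tendsto_one_div_add_atTop_nhds_zero_nat.comp hφ.tendsto_atTop)
  rw [h2]
  simpa using tendsto_const_nhds.add (h3.smul_const (1 : Matrix ι ι ℂ))

end PosSemidef

/-! ### Sums of two squares -/

theorem posSemidef_of_norm_le {s : ℝ} {w : ℂ} (h : ‖w‖ ≤ s) :
    (!![(s : ℂ), w; conj w, (s : ℂ)]).PosSemidef := by
  refine PosSemidef.of_dotProduct_mulVec_nonneg ?_ fun v => ?_
  · ext i j
    fin_cases i <;> fin_cases j <;> simp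
  · have h1 : star v ⬝ᵥ !![(s : ℂ), w; conj w, (s : ℂ)] *ᵥ v =
        ((s * (‖v 0‖ ^ 2 + ‖v 1‖ ^ 2) + 2 * (conj (v 0) * w * v 1).re : ℝ) : ℂ) := by
      push_cast
      rw [← Complex.conj_mul', ← Complex.conj_mul', Complex.re_eq_add_conj]
      simp [dotProduct, mulVec, Fin.sum_univ_two]
      ring
    rw [h1, Complex.zero_le_real]
    have h2 : -(‖v 0‖ * ‖w‖ * ‖v 1‖) ≤ (conj (v 0) * w * v 1).re := by
      have := (abs_le.1 (Complex.abs_re_le_norm (conj (v 0) * w * v 1))).1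
      simpa using this
    have h3 : ‖v 0‖ * ‖w‖ * ‖v 1‖ ≤ s * (‖v 0‖ * ‖v 1‖) := by
      nlinarith [mul_nonneg (norm_nonneg (v 0)) (norm_nonneg (v 1))]
    nlinarith [mul_nonneg ((norm_nonneg w).trans h) (sq_nonneg (‖v 0‖ - ‖v 1‖))]

/-- Rotating `w` to the negative real axis extracts `2‖w‖ ≤ s` from `s + 2 Re (z w) ≥ 0`. -/
theorem two_mul_norm_le_of_forall_nonneg {s w : ℂ}
    (h : ∀ z : Circle, 0 ≤ s + (z : ℂ) * w + conj ((z : ℂ) * w)) :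
    ∃ r : ℝ, s = ((2 * r : ℝ) : ℂ) ∧ ‖w‖ ≤ r := by
  obtain ⟨z, hz⟩ : ∃ z : Circle, (z : ℂ) * w = ((-‖w‖ : ℝ) : ℂ) := by
    refine ⟨Circle.exp (Real.pi - w.arg), ?_⟩
    nth_rewrite 2 [← Complex.norm_mul_exp_arg_mul_I w]
    rw [Circle.coe_exp, mul_left_comm, ← Complex.exp_add]
    push_cast
    rw [sub_mul, sub_add_cancel, Complex.exp_pi_mul_I]
    ring
  have h1 := h z
  rw [hz, Complex.conj_ofReal, Complex.le_def] at h1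
  simp only [Complex.add_re, Complex.add_im, Complex.ofReal_re, Complex.ofReal_im,
    Complex.zero_re, Complex.zero_im, add_zero] at h1
  refine ⟨s.re / 2, Complex.ext ?_ ?_, by linarith [h1.1]⟩
  · rw [Complex.ofReal_re]
    ring
  · rw [Complex.ofReal_im, ← h1.2]

/-- The polynomial `∑ₖ z₁ᵏ (pₖ + z₂ qₖ)`. -/
noncomputable def linearInSecond {n : ℕ} (p q : Fin (n + 1) → ℂ) : MvPolynomial (Fin 2) ℂ :=
  ∑ k : Fin (n + 1), (MvPolynomial.C (p k) + MvPolynomial.C (q k) * MvPolynomial.X 1) *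
    MvPolynomial.X 0 ^ (k : ℕ)

theorem hasBidegreeAtMost_linearInSecond {n : ℕ} (p q : Fin (n + 1) → ℂ) :
    HasBidegreeAtMost n 1 (linearInSecond p q) := by
  have key : ∀ (i : Fin 2) (k : Fin (n + 1)), MvPolynomial.degreeOf i
      ((MvPolynomial.C (p k) + MvPolynomial.C (q k) * MvPolynomial.X 1) *
        MvPolynomial.X 0 ^ (k : ℕ)) ≤ (if i = 1 then 1 else 0) + if i = 0 then n else 0 := by
    intro i k
    refine (MvPolynomial.degreeOf_mul_le _ _ _).trans (add_le_add ?_ ?_)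
    · refine (MvPolynomial.degreeOf_add_le _ _ _).trans (max_le (by simp) ?_)
      refine (MvPolynomial.degreeOf_mul_le _ _ _).trans ?_
      rw [MvPolynomial.degreeOf_C, MvPolynomial.degreeOf_X, zero_add]
    · refine (MvPolynomial.degreeOf_pow_le _ _ _).trans ?_
      rw [MvPolynomial.degreeOf_X]
      split_ifs
      · omega
      · simp
  constructor <;> refine (MvPolynomial.degreeOf_sum_le _ _ _).trans (Finset.sup_le fun k _ => ?_)
  · simpa using key 0 k
  · simpa using key 1 k

theorem eval_linearInSecond {n : ℕ} (p q : Fin (n + 1) → ℂ) (z w : ℂ) :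
    MvPolynomial.eval ![z, w] (linearInSecond p q) =
      ∑ k : Fin (n + 1), z ^ (k : ℕ) * p k + w * ∑ k : Fin (n + 1), z ^ (k : ℕ) * q k := by
  simp only [linearInSecond, map_sum, map_mul, map_add, map_pow, MvPolynomial.eval_C,
    MvPolynomial.eval_X, cons_val_zero, cons_val_one, Finset.mul_sum, ← Finset.sum_add_distrib]
  exact Finset.sum_congr rfl fun k _ => by ring

theorem fourier_apply_eq_zpow {T : ℝ} (k : ℤ) (x : AddCircle T) :
    fourier k x = (toCircle x : ℂ) ^ k := by
  rw [fourier_apply, toCircle_zsmul, Circle.coe_zpow]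

theorem mainTheorem3 (n : ℕ) (t : Circle → Circle → ℂ) (t₀ t₁ : Circle → ℂ)
    (ht₀ : IsTrigPolynomial n t₀) (ht₁ : IsTrigPolynomial n t₁)
    (ht : ∀ z₁ z₂ : Circle,
      t z₁ z₂ = t₀ z₁ + (z₂ : ℂ) * t₁ z₁ + conj ((z₂ : ℂ) * t₁ z₁))
    (hnonneg : ∀ z₁ z₂ : Circle, 0 ≤ t z₁ z₂) :
    ∃ A₁ A₂ : MvPolynomial (Fin 2) ℂ,
      HasBidegreeAtMost n 1 A₁ ∧ HasBidegreeAtMost n 1 A₂ ∧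
      ∀ z₁ z₂ : Circle,
        t z₁ z₂ = ((‖MvPolynomial.eval ![(z₁ : ℂ), (z₂ : ℂ)] A₁‖ ^ 2
          + ‖MvPolynomial.eval ![(z₁ : ℂ), (z₂ : ℂ)] A₂‖ ^ 2 : ℝ) : ℂ) := by
  obtain ⟨c₀, hc₀⟩ := ht₀
  obtain ⟨c₁, hc₁⟩ := ht₁
  have : Fact ((0 : ℝ) < 1) := ⟨one_pos⟩
  -- Splitting `t₀` evenly over the diagonal makes `M` positive semidefinite, as `2|t₁| ≤ t₀`.
  let M : AddCircle (1 : ℝ) → Matrix (Fin 2) (Fin 2) ℂ := fun x =>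
    !![t₀ (toCircle x) / 2, t₁ (toCircle x); conj (t₁ (toCircle x)), t₀ (toCircle x) / 2]
  have hMpos : ∀ x, (M x).PosSemidef := fun x => by
    obtain ⟨r, hr, hw⟩ := two_mul_norm_le_of_forall_nonneg
      (s := t₀ (toCircle x)) (w := t₁ (toCircle x)) fun z => ht _ z ▸ hnonneg _ z
    have h2 : t₀ (toCircle x) / 2 = r := by
      rw [hr]
      push_cast
      ring
    simp only [M, h2]
    exact posSemidef_of_norm_le hw
  have hMtrig : ∀ x, M x = ∑ p ∈ Finset.Icc (-(n : ℤ)) n, (fourier p x : ℂ) •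
      !![c₀ p / 2, c₁ p; conj (c₁ (-p)), c₀ p / 2] := fun x => by
    have h1 : conj (t₁ (toCircle x)) =
        ∑ p ∈ Finset.Icc (-(n : ℤ)) n, (fourier p x : ℂ) * conj (c₁ (-p)) := by
      rw [hc₁, map_sum]
      refine Finset.sum_bij (fun p _ => -p) (fun p hp => ?_) (fun p _ q _ h => neg_injective h)
        (fun p hp => ⟨-p, ?_, neg_neg p⟩) (fun p _ => ?_)
      · rw [Finset.mem_Icc] at hp ⊢
        omega
      · rw [Finset.mem_Icc] at hp ⊢
        omega
      · rw [fourier_neg, fourier_apply_eq_zpow, neg_neg, map_mul, mul_comm]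
    have h2 : t₁ (toCircle x) = ∑ p ∈ Finset.Icc (-(n : ℤ)) n, (fourier p x : ℂ) * c₁ p := by
      rw [hc₁]
      exact Finset.sum_congr rfl fun p _ => by rw [fourier_apply_eq_zpow, mul_comm]
    have h3 : t₀ (toCircle x) / 2 =
        ∑ p ∈ Finset.Icc (-(n : ℤ)) n, (fourier p x : ℂ) * (c₀ p / 2) := by
      rw [hc₀, Finset.sum_div]
      exact Finset.sum_congr rfl fun p _ => by
        rw [fourier_apply_eq_zpow, mul_div_assoc', mul_comm]
    ext i j
    rw [Matrix.sum_apply]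
    fin_cases i <;> fin_cases j
    exacts [h3, h2, h1, h3]
  obtain ⟨a, ha⟩ := exists_factor_of_posSemidef _ hMtrig hMpos
  refine ⟨linearInSecond (fun k => a k 0 0) (fun k => a k 0 1),
    linearInSecond (fun k => a k 1 0) (fun k => a k 1 1),
    hasBidegreeAtMost_linearInSecond _ _, hasBidegreeAtMost_linearInSecond _ _, fun z₁ z₂ => ?_⟩
  obtain ⟨x, rfl⟩ : ∃ x : AddCircle (1 : ℝ), toCircle x = z₁ :=
    ⟨(homeomorphCircle one_ne_zero).symm z₁, by
      rw [← homeomorphCircle_apply one_ne_zero, Homeomorph.apply_symm_apply]⟩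
  rw [eval_linearInSecond, eval_linearInSecond, ht]
  have hG : ∀ i j, (∑ k : Fin (n + 1), (fourier ((k : ℕ) : ℤ) x : ℂ) • a k) i j =
      ∑ k : Fin (n + 1), (toCircle x : ℂ) ^ (k : ℕ) * a k i j := fun i j => by
    rw [Matrix.sum_apply]
    exact Finset.sum_congr rfl fun k _ => by
      rw [Matrix.smul_apply, fourier_apply_eq_zpow, zpow_natCast, smul_eq_mul]
  simp_rw [← hG]
  have hx := ha x
  set G := ∑ k : Fin (n + 1), (fourier ((k : ℕ) : ℤ) x : ℂ) • a k
  have hentry : ∀ i j, M x i j = conj (G 0 i) * G 0 j + conj (G 1 i) * G 1 j := fun i j => by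
    rw [hx, mul_apply, Fin.sum_univ_two]
    rfl
  have h00 : t₀ (toCircle x) / 2 = _ := hentry 0 0
  have h01 : t₁ (toCircle x) = _ := hentry 0 1
  have h10 : conj (t₁ (toCircle x)) = _ := hentry 1 0
  have h11 : t₀ (toCircle x) / 2 = _ := hentry 1 1
  have hz : conj (z₂ : ℂ) * z₂ = 1 := by
    rw [Complex.conj_mul', Circle.norm_coe]
    norm_num
  push_cast
  rw [← Complex.conj_mul', ← Complex.conj_mul', ← add_halves (t₀ (toCircle x)), map_mul, h10]
  simp only [map_add, map_mul]
  nth_rewrite 1 [h00]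
  rw [h11, h01]
  linear_combination (-(conj (G 0 1) * G 0 1 + conj (G 1 1) * G 1 1)) * hz
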